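/- **Theorem (lower bound for the path-length regret).** For $d\ge 1$ let $\Theta=\mathbb{B}^d=\{x\in\mathbb{R}^d:\|x\|\le 1\}$ be the Euclidean unit ball. For $0<\alpha<\beta$ and $M>0$ let $\mathcal{F}_{\alpha,\beta,M}$ be the class of functions $f:\mathbb{R}^d\to\mathbb{R}$ that are $\alpha$-strongly convex, $\beta$-smooth (continuously differentiable with $\beta$-Lipschitz gradient) and satisfy $\max_{x\in\Theta}|f(x)|\le M$. *Protocol.* Losses $f_1,\dots,f_T\in\mathcal{F}_{\alpha,\beta,M}$ are fixed in advance. In round $t=1,\dots,T$ a randomized algorithm $\pi$ plays $z_t=\Phi_t\big(V,(z_k,y_k)_{k<t}\big)\in\Theta$, where $\Phi_t$ is a Borel function and $V$ is an internal random seed, and observes $y_t=f_t(z_t)+\xi_t$. The noise variables $\xi_t$ are independent of each other and of $V$, with a common distribution $F$ satisfying $$\int\log\Big(\frac{dF(u)}{dF(u+v)}\Big)\,dF(u)\le I_0v^2\qquad\text{for all } |v|<v_0,$$ where $0<I_0<\infty$ and $0<v_0\le\infty$ (the integral is a Kullback–Leibler divergence; in particular $F$ is absolutely continuous with respect to these shifts).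 For $P\ge 0$ the path-length regret is $$R^{\mathrm{pat}}(T,P)=\sup\Big\{\sum_{t=1}^T\mathbb{E}\big[f_t(z_t)-f_t(u_t)\big] \;:\; u_1,\dots,u_T\in\Theta,\ \sum_{t=2}^T\|u_t-u_{t-1}\|\le P\Big\}.$$ *Claim.* Let $0<\alpha<\beta$, $\alpha<4M$, $0<I_0<\infty$ and $0<v_0\le\infty$. There is a constant $c_2>0$, depending only on $\alpha,\beta,M,I_0,v_0$ (so not on $d$, $T$ and $P$), such that for all $d\ge1$ and $P\ge0$ there exists $T_0>0$ such that for every $T\ge T_0$, every noise distribution $F$ as above and every randomized algorithm $\pi$, $$\sup_{f_1,\dots,f_T\in\mathcal{F}_{\alpha,\beta,M}}R^{\mathrm{pat}}(T,P)\;\ge\; c_2\,(d^2P)^{2/5}\,T^{3/5}.$$ -/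

import Mathlib

open MeasureTheory Set
open scoped ENNReal

/-- `ℝ^d` with its Euclidean norm. -/
abbrev Euc (d : ℕ) : Type := EuclideanSpace ℝ (Fin d)

/-- The arm set: the closed unit Euclidean ball of `ℝ^d`. -/
def armSet (d : ℕ) : Set (Euc d) := Metric.closedBall 0 1

/-- A function is `β`-smooth if it is continuously differentiable with `β`-Lipschitz gradient. -/
def IsSmoothWith {d : ℕ} (β : ℝ) (f : Euc d → ℝ) : Prop :=
  ContDiff ℝ 1 f ∧ ∀ x z : Euc d, ‖gradient f x - gradient f z‖ ≤ β * ‖x - z‖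

/-- The admissible losses: `α`-strongly convex and `β`-smooth on `ℝ^d`, and bounded by `M` in
absolute value on the arm set. -/
def lossClass (d : ℕ) (α β M : ℝ) : Set (Euc d → ℝ) :=
  {f | StrongConvexOn univ α f ∧ IsSmoothWith β f ∧ ∀ x ∈ armSet d, |f x| ≤ M}

/-- The noise condition `∫ log (dF(u) / dF(u+v)) dF(u) ≤ I₀ v²` for `|v| < v₀`. The measure
`dF(u+v)` is the image of `F` under `u ↦ u - v`; the Kullback-Leibler divergence is infinite
when `F` is not absolutely continuous with respect to it. -/
def ShiftKLCondition (F : Measure ℝ) (I₀ : ℝ) (v₀ : ℝ≥0∞) : Prop :=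
  ∀ v : ℝ, ENNReal.ofReal |v| < v₀ →
    InformationTheory.klDiv F (F.map (fun u => u - v)) ≤ ENNReal.ofReal (I₀ * v ^ 2)

/-- A randomized bandit algorithm with internal randomness in `S`. Rounds are numbered from `0`.
In round `t` it plays a Borel function of its random seed and of the past actions and
observations `(z_k, y_k)`, `k < t`. -/
structure BanditAlgorithm (d : ℕ) (S : Type*) [MeasurableSpace S] where
  act : (t : ℕ) → S → (Fin t → Euc d × ℝ) → Euc d
  measurable_act : ∀ t, Measurable fun p : S × (Fin t → Euc d × ℝ) => act t p.1 p.2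
  act_mem : ∀ t s h, act t s h ∈ armSet d

namespace BanditAlgorithm

variable {d : ℕ} {S : Type*} [MeasurableSpace S]

/-- The pairs `(z_k, y_k)`, `k < t`, produced when the algorithm with seed `s` faces the losses `f`
and the noise `ξ`, where `y_k = f_k (z_k) + ξ_k`. -/
def history (π : BanditAlgorithm d S) (f : ℕ → Euc d → ℝ) (s : S) (ξ : ℕ → ℝ) :
    (t : ℕ) → Fin t → Euc d × ℝ
  | 0 => Fin.elim0
  | t + 1 =>
      Fin.snoc (α := fun _ => Euc d × ℝ) (π.history f s ξ t)
        (π.act t s (π.history f s ξ t), f t (π.act t s (π.history f s ξ t)) + ξ t)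

/-- The action `z_t`. -/
def action (π : BanditAlgorithm d S) (f : ℕ → Euc d → ℝ) (s : S) (ξ : ℕ → ℝ) (t : ℕ) : Euc d :=
  π.act t s (π.history f s ξ t)

/-- The regret `∑_t E[f_t(z_t) - f_t(u_t)]` over `T` rounds against the comparators `u`. The seed
has law `ρ`, the noise variables are independent with law `F`, and seed and noise are
independent. -/
noncomputable def regret (π : BanditAlgorithm d S) (ρ : Measure S) (F : Measure ℝ)
    (f : ℕ → Euc d → ℝ) (T : ℕ) (u : ℕ → Euc d) : ℝ :=
  ∑ t ∈ Finset.range T, ∫ p : S × (ℕ → ℝ), (f t (π.action f p.1 p.2 t) - f t (u t))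
    ∂(ρ.prod (Measure.infinitePi fun _ : ℕ => F))

end BanditAlgorithm

/-- The path-length `∑ ‖u_t - u_{t-1}‖` of the first `T` comparators. -/
noncomputable def pathLength {d : ℕ} (T : ℕ) (u : ℕ → Euc d) : ℝ :=
  ∑ t ∈ Finset.range (T - 1), ‖u (t + 1) - u t‖

/-- The comparator sequences in the arm set with path-length at most `P`. -/
def comparators (d T : ℕ) (P : ℝ) : Set (ℕ → Euc d) :=
  {u | (∀ t < T, u t ∈ armSet d) ∧ pathLength T u ≤ P}

/-- The path-length regret. The supremum is taken in the extended reals. -/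
noncomputable def pathRegret {d : ℕ} {S : Type*} [MeasurableSpace S] (π : BanditAlgorithm d S)
    (ρ : Measure S) (F : Measure ℝ) (f : ℕ → Euc d → ℝ) (T : ℕ) (P : ℝ) : EReal :=
  ⨆ u ∈ comparators d T P, (π.regret ρ F f T u : EReal)

/-! Perturb a quadratic in each coordinate by a sine of amplitude `ε h²` and wavelength of order
`h`. The perturbation has curvature of order `ε` whatever `h` is, so the class is respected, while
its sign decides on which side of 0, at distance `h w`, the minimizer lies. A coordinate with the
wrong sign costs at least `α/2 h² w²` (`sum_indicator_le_perturbedLoss_sub`).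

Cut time into blocks of `L` rounds with one sign vector per block. Flipping one sign moves the
losses by at most `2εh²`, on a single block, so the laws of the histories are at divergence at most
`L I₀ (2εh²)²` (`klDiv_historyLaw_le`). With `h = L^(-1/4)/2` this is a constant, and no algorithm
can detect the sign. Averaging over all sign patterns (Assouad's argument, `exists_le_regret`) gives
a pattern with regret of order `T d h²`, that is `T d / √L`.

The block minimizers have path-length at most `(T/L) · 2√d h`, which stays below `P` when `L` is
about `(T√d/P)^(4/5)`; then `T d / √L` is of order `(d²P)^(2/5) T^(3/5)`. Large `T` makes `h` so
small, in terms of `d`, that the ball, the bound `M` and `v₀` impose no constraint; the constant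
itself does not see `d`. -/

open ProbabilityTheory InformationTheory

/-! ### Kullback–Leibler divergence: two-point tests, kernels and shifts -/

section KullbackLeibler

variable {X : Type*} [MeasurableSpace X]

/-- For finite measures the divergence is the integral of the nonnegative function `klFun` of the
density, and restriction to a set does not change the density there. -/
lemma klDiv_restrict_le (μ ν : Measure X) [IsFiniteMeasure μ] [IsFiniteMeasure ν] {A : Set X}
    (hA : MeasurableSet A) : klDiv (μ.restrict A) (ν.restrict A) ≤ klDiv μ ν := by
  by_cases hac : μ ≪ ν
  swap
  · simp [hac]
  rw [klDiv_eq_lintegral_klFun_of_ac hac, klDiv_eq_lintegral_klFun_of_ac (hac.restrict A)]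
  have hμ : μ.restrict A = (ν.restrict A).withDensity (μ.rnDeriv ν) := by
    rw [← restrict_withDensity hA, Measure.withDensity_rnDeriv_eq _ _ hac]
  have hd : (μ.restrict A).rnDeriv (ν.restrict A) =ᵐ[ν.restrict A] μ.rnDeriv ν := by
    rw [hμ]
    exact Measure.rnDeriv_withDensity _ (Measure.measurable_rnDeriv _ _)
  calc _ = ∫⁻ x in A, ENNReal.ofReal (klFun (μ.rnDeriv ν x).toReal) ∂ν := by
        refine lintegral_congr_ae ?_
        filter_upwards [hd] with x hx
        rw [hx]
    _ ≤ _ := setLIntegral_le_lintegral _ _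

/-- A lower bound for the sum of the error probabilities of a test between two laws whose
Kullback-Leibler divergence is at most `K`. -/
lemma exp_le_measureReal_add_measureReal_compl (μ ν : Measure X) [IsProbabilityMeasure μ]
    [IsProbabilityMeasure ν] {K : ℝ} (hK : 0 ≤ K) (h : klDiv μ ν ≤ ENNReal.ofReal K) {A : Set X}
    (hA : MeasurableSet A) :
    Real.exp (-2 * (K + 1)) / 2 ≤ μ.real A + ν.real Aᶜ := by
  by_contra! hlt
  set s := Real.exp (-2 * (K + 1)) / 2 with hs
  have hs0 : 0 < s := by positivity
  have hs1 : s < 1 / 2 := by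
    have : Real.exp (-2 * (K + 1)) < 1 := by
      rw [Real.exp_lt_one_iff]; linarith
    linarith
  have hp0 : 0 ≤ μ.real A := measureReal_nonneg
  have hq0 : 0 ≤ ν.real Aᶜ := measureReal_nonneg
  have hp : μ.real Aᶜ = 1 - μ.real A := by
    rw [measureReal_compl hA]; simp
  -- For masses `p`, `q` of `Aᶜ` this reads `p log (p/q) + q - p ≤ K`. The `+ 1` in the exponent of
  -- the claimed bound absorbs the term `-p`.
  have hkl := (mul_log_le_klDiv (μ.restrict Aᶜ) (ν.restrict Aᶜ)).trans
    ((klDiv_restrict_le μ ν hA.compl).trans h)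
  rw [ENNReal.ofReal_le_ofReal_iff hK] at hkl
  simp only [measureReal_restrict_apply_univ] at hkl
  set p := μ.real Aᶜ
  set q := ν.real Aᶜ
  have hp2 : 1 / 2 < p := by linarith
  -- Needed because `p / 0 = 0` would make the logarithm useless; finite divergence gives absolute
  -- continuity, so `q = 0` would force `p = 0`.
  have hq : 0 < q := by
    refine lt_of_le_of_ne hq0 fun h0 => ?_
    have hz : ν Aᶜ = 0 := by
      rw [← measureReal_eq_zero_iff]; exact h0.symm
    have hac : μ ≪ ν := by
      by_contra hac
      rw [klDiv_of_not_ac hac] at h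
      exact absurd h (by simp)
    have : p = 0 := by
      simp [p, measureReal_def, hac hz]
    linarith
  have hlog : 2 * (K + 1) ≤ Real.log (p / q) := by
    rw [Real.le_log_iff_exp_le (by positivity), le_div_iff₀ hq]
    have hqs : q ≤ s := by linarith
    calc Real.exp (2 * (K + 1)) * q ≤ Real.exp (2 * (K + 1)) * s := by gcongr
      _ = 1 / 2 := by
        rw [hs, ← mul_div_assoc, ← Real.exp_add]; simp
      _ ≤ p := hp2.le
  have h1 : 1 / 2 * (2 * (K + 1)) ≤ p * Real.log (p / q) := by
    gcongr
  have : p ≤ 1 := by linarith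
  linarith

/-- The density of `μ ⊗ₘ κ` with respect to `μ ⊗ₘ η` is that of `κ x` with respect to `η x`, so the
divergence is the `μ`-average of the divergences of the fibres. -/
lemma klDiv_compProd_right_le {Y : Type*} [MeasurableSpace Y]
    [MeasurableSpace.CountableOrCountablyGenerated X Y] (μ : Measure X) [IsProbabilityMeasure μ]
    (κ η : Kernel X Y) [IsMarkovKernel κ] [IsMarkovKernel η] {c : ℝ≥0∞} (hc : c ≠ ∞)
    (h : ∀ x, klDiv (κ x) (η x) ≤ c) : klDiv (μ ⊗ₘ κ) (μ ⊗ₘ η) ≤ c := by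
  have hac : ∀ x, κ x ≪ η x := fun x => by
    by_contra hx
    have := h x
    rw [klDiv_of_not_ac hx] at this
    exact hc (top_le_iff.1 this)
  have hac' : μ ⊗ₘ κ ≪ μ ⊗ₘ η := .compProd_right (.of_forall hac)
  have hκ : κ = η.withDensity (κ.rnDeriv η) := by
    ext1 x
    exact (Kernel.withDensity_rnDeriv_eq (hac x)).symm
  have hd : (μ ⊗ₘ κ).rnDeriv (μ ⊗ₘ η) =ᵐ[μ ⊗ₘ η] fun p => κ.rnDeriv η p.1 p.2 := by
    have hm : Measurable fun p : X × Y => κ.rnDeriv η p.1 p.2 := Kernel.measurable_rnDeriv κ η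
    have : μ ⊗ₘ κ = (μ ⊗ₘ η).withDensity fun p => κ.rnDeriv η p.1 p.2 := by
      ext s hs
      rw [withDensity_apply _ hs, Measure.compProd_apply hs, ← lintegral_indicator hs,
        Measure.lintegral_compProd (hm.indicator hs)]
      refine lintegral_congr fun x => ?_
      have hsx : MeasurableSet (Prod.mk x ⁻¹' s) := measurable_prodMk_left hs
      conv_lhs => rw [hκ]
      rw [Kernel.withDensity_apply' _ hm, ← lintegral_indicator hsx]
      rfl
    conv_lhs => rw [this]
    exact Measure.rnDeriv_withDensity _ hm
  rw [klDiv_eq_lintegral_klFun_of_ac hac']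
  calc _ = ∫⁻ p, ENNReal.ofReal (klFun (κ.rnDeriv η p.1 p.2).toReal) ∂(μ ⊗ₘ η) := by
        refine lintegral_congr_ae ?_
        filter_upwards [hd] with x hx
        rw [hx]
    _ = ∫⁻ x, ∫⁻ y, ENNReal.ofReal (klFun (κ.rnDeriv η x y).toReal) ∂(η x) ∂μ := by
        rw [Measure.lintegral_compProd]
        have hm : Measurable fun p : X × Y => κ.rnDeriv η p.1 p.2 := Kernel.measurable_rnDeriv κ η
        fun_prop
    _ = ∫⁻ x, klDiv (κ x) (η x) ∂μ := by
        refine lintegral_congr fun x => ?_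
        rw [klDiv_eq_lintegral_klFun_of_ac (hac x)]
        refine lintegral_congr_ae ?_
        filter_upwards [Kernel.rnDeriv_eq_rnDeriv_measure (κ := κ) (η := η) (a := x)] with y hy
        rw [hy]
    _ ≤ ∫⁻ _, c ∂μ := lintegral_mono h
    _ = c := by simp

/-- The kernel giving the law of `g x + ξ`, where `ξ` has law `F`. -/
noncomputable def shiftKernel (F : Measure ℝ) [IsProbabilityMeasure F] {g : X → ℝ}
    (hg : Measurable g) : Kernel X ℝ where
  toFun x := F.map fun u => g x + u
  measurable' := by
    refine Measure.measurable_of_measurable_coe _ fun s hs => ?_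
    have : ∀ x, (F.map fun u => g x + u) s = F (Prod.mk x ⁻¹' {p : X × ℝ | g p.1 + p.2 ∈ s}) :=
      fun x => Measure.map_apply (by fun_prop) hs
    simp_rw [this]
    refine measurable_measure_prodMk_left ?_
    exact (by fun_prop : Measurable fun p : X × ℝ => g p.1 + p.2) hs

lemma shiftKernel_apply (F : Measure ℝ) [IsProbabilityMeasure F] {g : X → ℝ}
    (hg : Measurable g) (x : X) : shiftKernel F hg x = F.map fun u => g x + u := rfl

instance (F : Measure ℝ) [IsProbabilityMeasure F] {g : X → ℝ} (hg : Measurable g) :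
    IsMarkovKernel (shiftKernel F hg) :=
  ⟨fun x => by
    rw [shiftKernel_apply]
    exact Measure.isProbabilityMeasure_map (by fun_prop)⟩

lemma compProd_shiftKernel (μ : Measure X) [IsProbabilityMeasure μ] (F : Measure ℝ)
    [IsProbabilityMeasure F] {g : X → ℝ} (hg : Measurable g) :
    μ ⊗ₘ shiftKernel F hg = (μ.prod F).map fun p => (p.1, g p.1 + p.2) := by
  have hm : Measurable fun p : X × ℝ => (p.1, g p.1 + p.2) := by fun_prop
  ext s hs
  rw [Measure.compProd_apply hs, Measure.map_apply hm hs, Measure.prod_apply (hm hs)]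
  refine lintegral_congr fun x => ?_
  rw [shiftKernel_apply, Measure.map_apply (by fun_prop) (measurable_prodMk_left hs)]
  rfl

/-- Translating both laws by `-a` leaves only the shift `a - b`; data processing suffices for this.
-/
lemma ShiftKLCondition.klDiv_map_add_le {F : Measure ℝ} [IsProbabilityMeasure F] {I₀ : ℝ}
    {v₀ : ℝ≥0∞} (hF : ShiftKLCondition F I₀ v₀) {a b : ℝ} (hab : ENNReal.ofReal |a - b| < v₀) :
    klDiv (F.map fun u => a + u) (F.map fun u => b + u) ≤
      ENNReal.ofReal (I₀ * (a - b) ^ 2) := by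
  have : (F.map fun u => b + u) = (F.map fun u => u - (a - b)).map fun u => a + u := by
    rw [Measure.map_map (by fun_prop) (by fun_prop)]
    congr 1
    ext u
    simp only [Function.comp_apply]
    ring
  rw [this]
  have : IsProbabilityMeasure (F.map fun u => u - (a - b)) :=
    Measure.isProbabilityMeasure_map (by fun_prop)
  exact (klDiv_map_le _ _ (by fun_prop)).trans (hF _ hab)

end KullbackLeibler

/-! ### The hard losses: a quadratic with sine perturbations -/

section Loss

lemma convexOn_sq_half_sub_sin : ConvexOn ℝ univ fun y : ℝ => y ^ 2 / 2 - Real.sin y := by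
  refine convexOn_univ_of_deriv2_nonneg (by fun_prop) ?_ ?_
  all_goals
    have h1 : deriv (fun y : ℝ => y ^ 2 / 2 - Real.sin y) = fun y => y - Real.cos y := by
      ext y
      refine (((hasDerivAt_pow 2 y).div_const 2).sub (Real.hasDerivAt_sin y)).deriv.trans ?_
      norm_num
  · rw [h1]; fun_prop
  · intro x
    have h2 : deriv (fun y : ℝ => y - Real.cos y) x = 1 + Real.sin x := by
      refine ((hasDerivAt_id x).sub (Real.hasDerivAt_cos x)).deriv.trans ?_
      ring
    simp only [Function.iterate_succ, Function.iterate_zero, Function.comp_apply, id_eq]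
    rw [h1, h2]
    linarith [Real.neg_one_le_sin x]

lemma sub_cos_mul_sub_le (x w : ℝ) :
    (w - Real.cos w) * (x - w) ≤ (x ^ 2 / 2 - Real.sin x) - (w ^ 2 / 2 - Real.sin w) := by
  have hd : HasDerivAt (fun y : ℝ => y ^ 2 / 2 - Real.sin y) (w - Real.cos w) w := by
    refine (((hasDerivAt_pow 2 w).div_const 2).sub (Real.hasDerivAt_sin w)).congr_deriv ?_
    norm_num
  rcases lt_trichotomy x w with h | rfl | h
  · have := convexOn_sq_half_sub_sin.slope_le_of_hasDerivAt (mem_univ x) (mem_univ w) h hd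
    rw [slope_def_field, div_le_iff₀ (by linarith)] at this
    linarith
  · simp
  · have := convexOn_sq_half_sub_sin.le_slope_of_hasDerivAt (mem_univ w) (mem_univ x) h hd
    rw [slope_def_field, le_div_iff₀ (by linarith)] at this
    linarith

/-- This is the critical point equation of a coordinate in the variable `σ_i x_i / h`; hence `w`
does not depend on `h`. The intermediate value theorem applies on `[0, 1]` because `ε ≤ γ`. -/
lemma exists_mul_eq_mul_cos {γ ε : ℝ} (hε : 0 < ε) (hεγ : ε ≤ γ) :
    ∃ w : ℝ, 0 < w ∧ w ≤ 1 ∧ γ * w = ε * Real.cos w := by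
  have hc : ContinuousOn (fun w : ℝ => γ * w - ε * Real.cos w) (Icc 0 1) := by fun_prop
  have h1 : (0 : ℝ) ∈ Icc (γ * 0 - ε * Real.cos 0) (γ * 1 - ε * Real.cos 1) := by
    constructor
    · simp [hε.le]
    · nlinarith [Real.cos_le_one 1]
  obtain ⟨w, hw, h0⟩ := intermediate_value_Icc (by norm_num) hc h1
  refine ⟨w, lt_of_le_of_ne hw.1 ?_, hw.2, by simpa [sub_eq_zero] using h0⟩
  rintro rfl
  simp at h0
  exact hε.ne' h0

/-- A quadratic with oscillating perturbations of amplitude `ε h²` in each coordinate, whose signs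
are given by `σ`. -/
noncomputable def perturbedLoss {d : ℕ} (γ ε h : ℝ) (σ : Fin d → ℝ) (x : Euc d) : ℝ :=
  ∑ i, (γ / 2 * x i ^ 2 - ε * h ^ 2 * Real.sin (σ i * x i / h)) - γ / 4

/-- The point with coordinates `h w σ_i`. -/
noncomputable def scaledSign {d : ℕ} (h w : ℝ) (σ : Fin d → ℝ) : Euc d :=
  WithLp.toLp 2 fun i => h * w * σ i

variable {d : ℕ} {γ ε h : ℝ} {σ : Fin d → ℝ}

lemma contDiff_perturbedLoss {n : WithTop ℕ∞} : ContDiff ℝ n (perturbedLoss γ ε h σ) := by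
  unfold perturbedLoss
  fun_prop

lemma hasGradientAt_perturbedLoss (x : Euc d) :
    HasGradientAt (perturbedLoss γ ε h σ)
      (WithLp.toLp 2 fun i => γ * x i - ε * h * σ i * Real.cos (σ i * x i / h)) x := by
  rw [hasGradientAt_iff_hasFDerivAt]
  have hx : ∀ i, HasFDerivAt (fun x : Euc d => γ / 2 * x i ^ 2
      - ε * h ^ 2 * Real.sin (σ i * x i / h))
      ((γ * x i - ε * h * σ i * Real.cos (σ i * x i / h)) • EuclideanSpace.proj (𝕜 := ℝ) i) x := by
    intro i
    have h1 : HasDerivAt (fun y : ℝ => γ / 2 * y ^ 2 - ε * h ^ 2 * Real.sin (σ i * y / h))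
        (γ * x i - ε * h * σ i * Real.cos (σ i * x i / h)) (x i) := by
      have h2 : HasDerivAt (fun y : ℝ => σ i * y / h) (σ i / h) (x i) := by
        simpa using ((hasDerivAt_id (x i)).const_mul (σ i)).div_const h
      refine (((hasDerivAt_pow 2 (x i)).const_mul (γ / 2)).sub
        (h2.sin.const_mul (ε * h ^ 2))).congr_deriv ?_
      field_simp
      norm_num
      ring
    exact h1.comp_hasFDerivAt x (EuclideanSpace.proj (𝕜 := ℝ) i).hasFDerivAt
  have hs := (HasFDerivAt.fun_sum (u := Finset.univ) fun i _ => hx i).sub_const (γ / 4)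
  refine hs.congr_fderiv ?_
  ext y
  simp [PiLp.inner_apply, mul_comm]

/-- The derivative of the perturbation has amplitude and wavelength both of order `h`, so its
Lipschitz constant is independent of `h`. -/
lemma abs_mul_cos_sub_cos_le (hh : 0 < h) {s : ℝ} (hs : |s| = 1) (a b : ℝ) :
    |h * s * (Real.cos (s * a / h) - Real.cos (s * b / h))| ≤ |a - b| := by
  have h1 : |Real.cos (s * a / h) - Real.cos (s * b / h)| ≤ |s * a / h - s * b / h| := by
    rw [← Real.dist_eq, ← Real.dist_eq]
    simpa using Real.lipschitzWith_cos.dist_le_mul (s * a / h) (s * b / h)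
  rw [← sub_div, ← mul_sub, abs_div, abs_mul, hs, abs_of_pos hh, one_mul] at h1
  rw [abs_mul, abs_mul, hs, abs_of_pos hh]
  rw [le_div_iff₀ hh] at h1
  linarith

lemma isSmoothWith_perturbedLoss {β : ℝ} (hγ : 0 ≤ γ) (hε : 0 ≤ ε) (hβ : γ + ε ≤ β) (hh : 0 < h)
    (hσ : ∀ i, |σ i| = 1) : IsSmoothWith β (perturbedLoss γ ε h σ) := by
  refine ⟨contDiff_perturbedLoss, fun x z => ?_⟩
  rw [(hasGradientAt_perturbedLoss x).gradient,
    (hasGradientAt_perturbedLoss z).gradient]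
  have hβ0 : 0 ≤ β := by linarith
  refine le_of_sq_le_sq ?_ (by positivity)
  rw [mul_pow, EuclideanSpace.real_norm_sq_eq, EuclideanSpace.real_norm_sq_eq, Finset.mul_sum]
  refine Finset.sum_le_sum fun i _ => ?_
  simp only [PiLp.sub_apply]
  rw [← mul_pow, sq_le_sq, abs_mul, abs_of_nonneg hβ0]
  have h1 := abs_mul_cos_sub_cos_le hh (hσ i) (x i) (z i)
  calc |γ * x i - ε * h * σ i * Real.cos (σ i * x i / h)
        - (γ * z i - ε * h * σ i * Real.cos (σ i * z i / h))|
      = |γ * (x i - z i)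
        - ε * (h * σ i * (Real.cos (σ i * x i / h) - Real.cos (σ i * z i / h)))| := by
        congr 1; ring
    _ ≤ γ * |x i - z i| + ε * |x i - z i| := by
        refine (abs_sub _ _).trans ?_
        rw [abs_mul, abs_mul, abs_of_nonneg hγ, abs_of_nonneg hε]
        gcongr
    _ = (γ + ε) * |x i - z i| := by ring
    _ ≤ β * |x i - z i| := by gcongr

lemma convexOn_univ_sum {ι E : Type*} [AddCommGroup E] [Module ℝ E] {s : Finset ι} {f : ι → E → ℝ}
    (hf : ∀ i, ConvexOn ℝ univ (f i)) : ConvexOn ℝ univ fun x => ∑ i ∈ s, f i x := by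
  classical
  induction s using Finset.induction_on with
  | empty => simpa using convexOn_const (0 : ℝ) convex_univ
  | insert a s ha ih =>
    simp_rw [Finset.sum_insert ha]
    exact (hf a).add ih

/-- Of the curvature `γ = α + ε`, the part `ε` is spent on making `ε h² (u²/2 - sin u)` convex in `u
= σ_i x_i / h`; the part `α` remains. -/
lemma strongConvexOn_perturbedLoss {α : ℝ} (hε : 0 ≤ ε) (hγ : γ = α + ε) (hh : h ≠ 0)
    (hσ : ∀ i, |σ i| = 1) : StrongConvexOn univ α (perturbedLoss γ ε h σ) := by
  rw [strongConvexOn_iff_convex]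
  have h1 : ∀ i : Fin d, ConvexOn ℝ univ fun x : Euc d =>
      (σ i * x i / h) ^ 2 / 2 - Real.sin (σ i * x i / h) := fun i => by
    have := convexOn_sq_half_sub_sin.comp_linearMap
      ((σ i / h) • (EuclideanSpace.proj (𝕜 := ℝ) i : Euc d →L[ℝ] ℝ).toLinearMap)
    refine this.congr fun x _ => ?_
    simp [div_mul_eq_mul_div]
  have h2 : ConvexOn ℝ univ fun x : Euc d => ∑ i, ε * h ^ 2 *
      ((σ i * x i / h) ^ 2 / 2 - Real.sin (σ i * x i / h)) :=
    convexOn_univ_sum fun i => (h1 i).smul (by positivity)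
  refine (h2.sub (concaveOn_const (γ / 4) convex_univ)).congr fun x _ => Eq.symm ?_
  simp only [perturbedLoss, Pi.sub_apply]
  rw [EuclideanSpace.real_norm_sq_eq, Finset.mul_sum, sub_right_comm, ← Finset.sum_sub_distrib]
  congr 1
  refine Finset.sum_congr rfl fun i _ => ?_
  have : (σ i) ^ 2 = 1 := by rw [← sq_abs, hσ, one_pow]
  rw [div_pow, mul_pow, this, hγ]
  field_simp
  ring

/-- On the ball the quadratic part ranges over `[0, γ/2]`; subtracting `γ/4` centres it, which is
why `α < 4M` is enough. -/
lemma abs_perturbedLoss_le {M : ℝ} (hγ : 0 ≤ γ) (hε : 0 ≤ ε)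
    (hM : γ / 4 + d * (ε * h ^ 2) ≤ M) {x : Euc d} (hx : x ∈ armSet d) :
    |perturbedLoss γ ε h σ x| ≤ M := by
  have hx1 : ‖x‖ ^ 2 ≤ 1 := by
    have : ‖x‖ ≤ 1 := by simpa [armSet] using hx
    nlinarith [norm_nonneg x]
  have hs : |∑ i, ε * h ^ 2 * Real.sin (σ i * x i / h)| ≤ d * (ε * h ^ 2) := by
    refine (Finset.abs_sum_le_sum_abs _ _).trans ?_
    calc _ ≤ ∑ _i : Fin d, ε * h ^ 2 := by
          refine Finset.sum_le_sum fun i _ => ?_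
          rw [abs_mul, abs_of_nonneg (by positivity : 0 ≤ ε * h ^ 2)]
          exact mul_le_of_le_one_right (by positivity) (Real.abs_sin_le_one _)
      _ = _ := by simp
  have hf : perturbedLoss γ ε h σ x = γ / 2 * ‖x‖ ^ 2
      - ∑ i, ε * h ^ 2 * Real.sin (σ i * x i / h) - γ / 4 := by
    rw [perturbedLoss, Finset.sum_sub_distrib, EuclideanSpace.real_norm_sq_eq, Finset.mul_sum]
  rw [hf, abs_le]
  rw [abs_le] at hs
  constructor <;> nlinarith [sq_nonneg ‖x‖]

lemma perturbedLoss_mem_lossClass {α β M : ℝ} (hα : 0 < α) (hε : 0 ≤ ε) (hγ : γ = α + ε)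
    (hβ : γ + ε ≤ β) (hh : 0 < h) (hσ : ∀ i, |σ i| = 1) (hM : γ / 4 + d * (ε * h ^ 2) ≤ M) :
    perturbedLoss γ ε h σ ∈ lossClass d α β M :=
  ⟨strongConvexOn_perturbedLoss hε hγ hh.ne' hσ,
    isSmoothWith_perturbedLoss (by linarith) hε hβ hh hσ,
    fun _ hx => abs_perturbedLoss_le (by linarith) hε hM hx⟩

lemma norm_scaledSign_sub_le {w : ℝ} {σ' : Fin d → ℝ} (hh : 0 ≤ h) (hw : 0 ≤ w)
    (hσ : ∀ i, |σ i| = 1) (hσ' : ∀ i, |σ' i| = 1) :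
    ‖scaledSign h w σ - scaledSign h w σ'‖ ≤ 2 * Real.sqrt d * h * w := by
  have hle : ∀ i, (h * w * σ i - h * w * σ' i) ^ 2 ≤ (2 * h * w) ^ 2 := fun i => by
    rw [← mul_sub, mul_assoc 2, mul_comm 2, mul_pow (h * w), mul_pow (h * w)]
    refine mul_le_mul_of_nonneg_left ?_ (by positivity)
    have := (abs_sub (σ i) (σ' i)).trans_eq (by rw [hσ, hσ'])
    rw [← sq_abs]
    nlinarith [abs_nonneg (σ i - σ' i)]
  refine le_of_sq_le_sq ?_ (by positivity)
  rw [EuclideanSpace.real_norm_sq_eq]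
  calc _ ≤ ∑ _i : Fin d, (2 * h * w) ^ 2 := Finset.sum_le_sum fun i _ => by
        simpa [scaledSign] using hle i
    _ = d * (2 * h * w) ^ 2 := by simp
    _ = _ := by
      have := Real.sq_sqrt (Nat.cast_nonneg (α := ℝ) d)
      linear_combination -4 * h ^ 2 * w ^ 2 * this

lemma scaledSign_mem_armSet {w : ℝ} (hh : 0 ≤ h) (hw : 0 ≤ w) (hw1 : w ≤ 1)
    (hd : Real.sqrt d * h ≤ 1) (hσ : ∀ i, |σ i| = 1) : scaledSign h w σ ∈ armSet d := by
  rw [armSet, mem_closedBall_zero_iff]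
  refine le_of_sq_le_sq ?_ (by norm_num)
  rw [EuclideanSpace.real_norm_sq_eq]
  calc ∑ i, (scaledSign h w σ) i ^ 2 = ∑ _i : Fin d, (h * w) ^ 2 := by
        refine Finset.sum_congr rfl fun i _ => ?_
        rw [scaledSign, mul_pow, ← sq_abs (σ i), hσ]
        ring
    _ = (Real.sqrt d * h) ^ 2 * w ^ 2 := by
        rw [mul_pow (Real.sqrt d), Real.sq_sqrt (by positivity)]
        simp
        ring
    _ ≤ 1 ^ 2 * 1 ^ 2 := by gcongr
    _ = 1 ^ 2 := by norm_num

/-- Each coordinate whose sign is wrong contributes to the excess loss over the minimizer. -/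
lemma sum_indicator_le_perturbedLoss_sub {α w : ℝ} (hα : 0 ≤ α) (hε : 0 ≤ ε) (hγ : γ = α + ε)
    (hh : 0 < h) (hw : 0 ≤ w) (hwε : γ * w = ε * Real.cos w) (hσ : ∀ i, |σ i| = 1) (x : Euc d) :
    ∑ i, (if σ i * x i ≤ 0 then α / 2 * h ^ 2 * w ^ 2 else 0) ≤
      perturbedLoss γ ε h σ x - perturbedLoss γ ε h σ (scaledSign h w σ) := by
  rw [perturbedLoss, perturbedLoss, sub_sub_sub_cancel_right, ← Finset.sum_sub_distrib]
  refine Finset.sum_le_sum fun i _ => ?_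
  have hσ2 : (σ i) ^ 2 = 1 := by rw [← sq_abs, hσ, one_pow]
  obtain ⟨y, hy⟩ : ∃ y, σ i * x i = h * y := ⟨σ i * x i / h, by field_simp⟩
  have hx2 : x i ^ 2 = h ^ 2 * y ^ 2 := by rw [← mul_pow, ← hy, mul_pow, hσ2, one_mul]
  have h1 : σ i * (scaledSign h w σ) i / h = w := by
    rw [scaledSign, div_eq_iff hh.ne']
    linear_combination h * w * hσ2
  have h2 : ((scaledSign h w σ) i) ^ 2 = h ^ 2 * w ^ 2 := by
    rw [scaledSign]
    linear_combination h ^ 2 * w ^ 2 * hσ2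
  have h3 : σ i * x i / h = y := by rw [hy]; field_simp
  -- Split `γ/2 y²` into `α/2 y² + ε/2 y²` and use the tangent inequality at `w` for `y²/2 - sin y`;
  -- the linear terms cancel by the critical point equation.
  have key : α / 2 * (y - w) ^ 2 ≤
      (γ / 2 * y ^ 2 - ε * Real.sin y) - (γ / 2 * w ^ 2 - ε * Real.sin w) := by
    have := mul_le_mul_of_nonneg_left (sub_cos_mul_sub_le y w) hε
    have h4 : (γ * w - ε * Real.cos w) * (y - w) = 0 := by rw [hwε]; ring
    rw [hγ] at h4 ⊢
    linarith
  have hr : γ / 2 * x i ^ 2 - ε * h ^ 2 * Real.sin (σ i * x i / h) -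
      (γ / 2 * (scaledSign h w σ) i ^ 2 -
        ε * h ^ 2 * Real.sin (σ i * (scaledSign h w σ) i / h)) =
      h ^ 2 * ((γ / 2 * y ^ 2 - ε * Real.sin y) - (γ / 2 * w ^ 2 - ε * Real.sin w)) := by
    rw [h1, h2, h3, hx2]
    ring
  rw [hr]
  refine le_trans ?_ (mul_le_mul_of_nonneg_left key (sq_nonneg h))
  split_ifs with hc
  · have hy0 : y ≤ 0 := by
      rw [hy] at hc
      exact nonpos_of_mul_nonpos_right hc hh
    have : w ^ 2 ≤ (y - w) ^ 2 := by nlinarith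
    calc _ = h ^ 2 * (α / 2 * w ^ 2) := by ring
      _ ≤ _ := by gcongr
  · positivity

/-- Changing one sign changes the loss by at most twice the amplitude of the perturbation. -/
lemma abs_perturbedLoss_sub_le (hε : 0 ≤ ε) {σ' : Fin d → ℝ} (i : Fin d)
    (hσ : ∀ j, j ≠ i → σ j = σ' j) (x : Euc d) :
    |perturbedLoss γ ε h σ x - perturbedLoss γ ε h σ' x| ≤ 2 * (ε * h ^ 2) := by
  rw [perturbedLoss, perturbedLoss, sub_sub_sub_cancel_right, ← Finset.sum_sub_distrib,
    Finset.sum_eq_single i (fun j _ hj => by rw [hσ j hj, sub_self]) (by simp),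
    sub_sub_sub_cancel_left, ← mul_sub, abs_mul, abs_of_nonneg (by positivity : 0 ≤ ε * h ^ 2),
    mul_comm 2]
  gcongr
  refine (abs_sub _ _).trans ?_
  linarith [Real.abs_sin_le_one (σ' i * x i / h), Real.abs_sin_le_one (σ i * x i / h)]

end Loss

/-! ### Resampling one noise variable -/

section ProductMeasure

lemma measurable_update_prod (t : ℕ) :
    Measurable fun p : (ℕ → ℝ) × ℝ => Function.update p.1 t p.2 := by
  rw [measurable_pi_iff]
  intro k
  by_cases hk : k = t
  · subst hk
    simpa using measurable_snd
  · simp only [Function.update_of_ne hk]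
    fun_prop

lemma map_update_infinitePi_prod (F : Measure ℝ) [IsProbabilityMeasure F] (t : ℕ) :
    ((Measure.infinitePi fun _ : ℕ => F).prod F).map
      (fun p : (ℕ → ℝ) × ℝ => Function.update p.1 t p.2) = Measure.infinitePi fun _ : ℕ => F := by
  have hm := measurable_update_prod t
  refine Measure.eq_infinitePi _ fun s B hB => ?_
  rw [Measure.map_apply hm (.pi s.countable_toSet fun i _ => hB i)]
  have hpre : (fun p : (ℕ → ℝ) × ℝ => Function.update p.1 t p.2) ⁻¹' (Set.pi s B) =
      (Set.pi (s.erase t) B) ×ˢ (if t ∈ s then B t else univ) := by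
    ext p
    simp only [mem_preimage, Set.mem_pi, mem_prod, Finset.mem_coe, Finset.mem_erase]
    constructor
    · intro h
      refine ⟨fun i hi => by simpa [hi.1] using h i hi.2, ?_⟩
      split_ifs with ht
      · simpa using h t ht
      · trivial
    · rintro ⟨h1, h2⟩ i hi
      by_cases hit : i = t
      · subst hit
        simpa [hi] using h2
      · simpa [hit] using h1 i ⟨hit, hi⟩
  rw [hpre, Measure.prod_prod, Measure.infinitePi_pi _ fun i _ => hB i]
  split_ifs with ht
  · rw [mul_comm, Finset.mul_prod_erase s (fun i => F (B i)) ht]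
  · simp [Finset.erase_eq_of_notMem ht]

/-- A function of the seed and the noise that does not involve the noise variable of index `t` is
independent of that variable. -/
lemma map_prodMk_eval_eq_prod {S X : Type*} [MeasurableSpace S] [MeasurableSpace X] (ρ : Measure S)
    [IsProbabilityMeasure ρ] (F : Measure ℝ) [IsProbabilityMeasure F] (t : ℕ)
    {G : S × (ℕ → ℝ) → X} (hG : Measurable G)
    (hGt : ∀ s ξ u, G (s, Function.update ξ t u) = G (s, ξ)) :
    (ρ.prod (Measure.infinitePi fun _ : ℕ => F)).map (fun p => (G p, p.2 t)) =
      ((ρ.prod (Measure.infinitePi fun _ : ℕ => F)).map G).prod F := by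
  have hm := measurable_update_prod t
  -- Replace the noise of index `t` by a fresh independent copy: the law is unchanged, and `G` does
  -- not notice.
  have h1 : ρ.prod (Measure.infinitePi fun _ : ℕ => F) =
      (ρ.prod ((Measure.infinitePi fun _ : ℕ => F).prod F)).map
        (Prod.map id fun p : (ℕ → ℝ) × ℝ => Function.update p.1 t p.2) := by
    rw [← Measure.map_prod_map _ _ measurable_id hm, Measure.map_id, map_update_infinitePi_prod]
  conv_lhs => rw [h1]
  rw [Measure.map_map (by fun_prop) (by fun_prop), ← Measure.prodAssoc_prod,
    Measure.map_map (by fun_prop) (by fun_prop)]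
  have h2 := Measure.map_prod_map (ρ.prod (Measure.infinitePi fun _ : ℕ => F)) F hG measurable_id
  rw [Measure.map_id] at h2
  rw [h2]
  congr 1
  funext p
  refine Prod.ext (hGt _ _ _) ?_
  exact Function.update_self _ _ _

end ProductMeasure

/-! ### The law of the history and its divergence -/

namespace BanditAlgorithm

variable {d : ℕ} {S : Type*} [MeasurableSpace S] (π : BanditAlgorithm d S)

lemma measurable_snoc {A X : Type*} [MeasurableSpace A] [MeasurableSpace X] {t : ℕ}
    {g : X → Fin t → A} {a : X → A} (hg : Measurable g) (ha : Measurable a) :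
    Measurable fun x => (Fin.snoc (α := fun _ => A) (g x) (a x) : Fin (t + 1) → A) := by
  rw [measurable_pi_iff]
  intro i
  refine Fin.lastCases ?_ (fun j => ?_) i
  · simpa using ha
  · simpa [Function.comp_def] using (measurable_pi_apply j).comp hg

/-- Appends the action and the observation `y` of round `t` to the history. -/
def extend (t : ℕ) (p : (S × (Fin t → Euc d × ℝ)) × ℝ) : S × (Fin (t + 1) → Euc d × ℝ) :=
  (p.1.1, Fin.snoc (α := fun _ => Euc d × ℝ) p.1.2 (π.act t p.1.1 p.1.2, p.2))

lemma measurable_extend (t : ℕ) : Measurable (π.extend t) := by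
  have := π.measurable_act t
  refine Measurable.prodMk (by fun_prop) (measurable_snoc (by fun_prop) ?_)
  exact Measurable.prodMk (this.comp measurable_fst) measurable_snd

variable {f f' : ℕ → Euc d → ℝ}

lemma measurable_loss_act (hf : ∀ t, Measurable (f t)) (t : ℕ) :
    Measurable fun p : S × (Fin t → Euc d × ℝ) => f t (π.act t p.1 p.2) :=
  (hf t).comp (π.measurable_act t)

lemma measurable_history (hf : ∀ t, Measurable (f t)) (t : ℕ) :
    Measurable fun p : S × (ℕ → ℝ) => (p.1, π.history f p.1 p.2 t) := by
  induction t with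
  | zero => exact Measurable.prodMk measurable_fst measurable_const
  | succ t ih =>
    have h1 : Measurable fun p : S × (ℕ → ℝ) => f t (π.act t p.1 (π.history f p.1 p.2 t)) :=
      (π.measurable_loss_act hf t).comp ih
    have h2 : Measurable fun p : S × (ℕ → ℝ) =>
        f t (π.act t p.1 (π.history f p.1 p.2 t)) + p.2 t :=
      h1.add ((measurable_pi_apply t).comp measurable_snd)
    exact (π.measurable_extend t).comp (ih.prodMk h2)

lemma history_update (s : S) (ξ : ℕ → ℝ) {t k : ℕ} (htk : t ≤ k) (u : ℝ) :
    π.history f s (Function.update ξ k u) t = π.history f s ξ t := by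
  induction t with
  | zero => rfl
  | succ t ih =>
    rw [history, history, ih (by lia), Function.update_of_ne (by lia)]

/-- The joint law of the seed and of the history before round `t`. -/
noncomputable def historyLaw (ρ : Measure S) (F : Measure ℝ) (f : ℕ → Euc d → ℝ) (t : ℕ) :
    Measure (S × (Fin t → Euc d × ℝ)) :=
  (ρ.prod (Measure.infinitePi fun _ : ℕ => F)).map fun p => (p.1, π.history f p.1 p.2 t)

variable (ρ : Measure S) [IsProbabilityMeasure ρ] (F : Measure ℝ) [IsProbabilityMeasure F]

lemma isProbabilityMeasure_historyLaw (hf : ∀ t, Measurable (f t)) (t : ℕ) :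
    IsProbabilityMeasure (π.historyLaw ρ F f t) :=
  Measure.isProbabilityMeasure_map (π.measurable_history hf t).aemeasurable

/-- The history before round `t` does not involve the noise of round `t`, so given that history the
observation is a shift of fresh noise. This Markov form makes the chain rule available. -/
lemma historyLaw_succ (hf : ∀ t, Measurable (f t)) (t : ℕ) :
    π.historyLaw ρ F f (t + 1) =
      (π.historyLaw ρ F f t ⊗ₘ shiftKernel F (π.measurable_loss_act hf t)).map (π.extend t) := by
  have := π.isProbabilityMeasure_historyLaw ρ F hf t
  have hm : Measurable fun p : (S × (Fin t → Euc d × ℝ)) × ℝ =>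
      (p.1, f t (π.act t p.1.1 p.1.2) + p.2) := by
    have := (π.measurable_loss_act hf t).comp
      (measurable_fst : Measurable fun p : (S × (Fin t → Euc d × ℝ)) × ℝ => p.1)
    exact measurable_fst.prodMk (this.add measurable_snd)
  have hh := π.measurable_history hf t
  have hp : Measurable fun p : S × (ℕ → ℝ) => ((p.1, π.history f p.1 p.2 t), p.2 t) :=
    hh.prodMk ((measurable_pi_apply t).comp measurable_snd)
  rw [compProd_shiftKernel, historyLaw, historyLaw,
    ← map_prodMk_eval_eq_prod ρ F t hh (fun s ξ u => by rw [π.history_update s ξ le_rfl u]),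
    Measure.map_map hm hp, Measure.map_map (π.measurable_extend t) (hm.comp hp)]
  rfl

/-- The divergence between the laws of the histories generated by two sequences of losses. -/
lemma klDiv_historyLaw_le {I₀ : ℝ} {v₀ : ℝ≥0∞} (hF : ShiftKLCondition F I₀ v₀) (hI₀ : 0 ≤ I₀)
    (hf : ∀ t, Measurable (f t)) (hf' : ∀ t, Measurable (f' t)) {δ : ℕ → ℝ}
    (hδ : ∀ k, ENNReal.ofReal (δ k) < v₀) (t : ℕ)
    (hff' : ∀ k < t, ∀ x, |f k x - f' k x| ≤ δ k) :
    klDiv (π.historyLaw ρ F f t) (π.historyLaw ρ F f' t) ≤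
      ∑ k ∈ Finset.range t, ENNReal.ofReal (I₀ * δ k ^ 2) := by
  induction t with
  | zero =>
    have := π.isProbabilityMeasure_historyLaw ρ F hf 0
    have h0 : π.historyLaw ρ F f 0 = π.historyLaw ρ F f' 0 := rfl
    rw [← h0, klDiv_self]
    exact zero_le
  | succ t ih =>
    have := π.isProbabilityMeasure_historyLaw ρ F hf t
    have := π.isProbabilityMeasure_historyLaw ρ F hf' t
    rw [π.historyLaw_succ ρ F hf, π.historyLaw_succ ρ F hf', Finset.sum_range_succ]
    refine (klDiv_map_le _ _ (π.measurable_extend t)).trans ?_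
    rw [klDiv_compProd_eq_add]
    refine add_le_add (ih fun k hk => hff' k (by lia)) ?_
    -- Given the same seed and history, the algorithm plays the same point against both sequences,
    -- so the observations differ only by a shift of size at most `δ t`.
    refine klDiv_compProd_right_le _ _ _ ENNReal.ofReal_ne_top fun x => ?_
    have hx := hff' t (by lia) (π.act t x.1 x.2)
    rw [shiftKernel_apply, shiftKernel_apply]
    refine (hF.klDiv_map_add_le ((ENNReal.ofReal_le_ofReal hx).trans_lt (hδ t))).trans ?_
    refine ENNReal.ofReal_le_ofReal ?_
    rw [← sq_abs]
    gcongr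

end BanditAlgorithm

/-! ### Signs that are constant on blocks of rounds -/

section Blocks

variable {T d : ℕ}

/-- The signs that are in force in round `t` when they change every `L` rounds: `ω` prescribes one
sign for every block of rounds and every coordinate. -/
noncomputable def blockSign [NeZero T] (L : ℕ) (ω : Fin T × Fin d → Bool) (t : ℕ) (i : Fin d) :
    ℝ :=
  if ω (Fin.ofNat T (t / L), i) then 1 else -1

/-- Reverses the sign of index `p`. -/
def flipSign (p : Fin T × Fin d) (ω : Fin T × Fin d → Bool) : Fin T × Fin d → Bool :=
  Function.update ω p (!ω p)

lemma flipSign_involutive (p : Fin T × Fin d) : Function.Involutive (flipSign p) := fun ω => by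
  simp [flipSign]

variable [NeZero T]

lemma abs_blockSign (L : ℕ) (ω : Fin T × Fin d → Bool) (t : ℕ) (i : Fin d) :
    |blockSign L ω t i| = 1 := by
  unfold blockSign
  split_ifs <;> simp

lemma blockSign_flipSign_self (L : ℕ) (ω : Fin T × Fin d → Bool) (t : ℕ) (i : Fin d) :
    blockSign L (flipSign (Fin.ofNat T (t / L), i) ω) t i = -blockSign L ω t i := by
  unfold blockSign flipSign
  cases ω (Fin.ofNat T (t / L), i) <;> simp

lemma blockSign_flipSign_of_ne (L : ℕ) (ω : Fin T × Fin d → Bool) {p : Fin T × Fin d} {t : ℕ}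
    {i : Fin d} (h : (Fin.ofNat T (t / L), i) ≠ p) :
    blockSign L (flipSign p ω) t i = blockSign L ω t i := by
  unfold blockSign flipSign
  rw [Function.update_of_ne h]

/-- Block indices are reduced modulo `T`, but rounds before `T` have indices below `T`, so distinct
blocks use distinct signs. -/
lemma blockSign_flipSign_of_div_ne {L : ℕ} (ω : Fin T × Fin d → Bool) {k t : ℕ} (hk : k < T)
    (ht : t < T) (h : k / L ≠ t / L) (i : Fin d) :
    blockSign L (flipSign (Fin.ofNat T (t / L), i) ω) k = blockSign L ω k := by
  ext j
  refine blockSign_flipSign_of_ne L ω fun he => h ?_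
  have h1 := congrArg (fun p => p.1.val) he
  simpa [Fin.ofNat, Nat.mod_eq_of_lt ((Nat.div_le_self k L).trans_lt hk),
    Nat.mod_eq_of_lt ((Nat.div_le_self t L).trans_lt ht)] using h1

lemma card_filter_div_eq_le {L : ℕ} (hL : 0 < L) (s : Finset ℕ) (q : ℕ) :
    (s.filter fun k => k / L = q).card ≤ L := by
  calc _ ≤ (Finset.Ico (L * q) (L * q + L)).card := by
        refine Finset.card_le_card fun k hk => ?_
        obtain ⟨_, rfl⟩ := Finset.mem_filter.1 hk
        exact Finset.mem_Ico.2 ⟨Nat.mul_div_le k L, by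
          have := Nat.lt_mul_div_succ k hL
          rwa [mul_add, mul_one] at this⟩
    _ = L := by simp

/-- The point moves only when `t / L` increases. Charging each move to that increase makes the sum
telescope. -/
lemma pathLength_scaledSign_le {h w : ℝ} (hh : 0 ≤ h) (hw : 0 ≤ w) (L : ℕ)
    (ω : Fin T × Fin d → Bool) (N : ℕ) :
    pathLength N (fun t => scaledSign h w (blockSign L ω t)) ≤
      ((N - 1) / L : ℕ) * (2 * Real.sqrt d * h * w) := by
  have hC : 0 ≤ 2 * Real.sqrt d * h * w := by positivity
  have hstep : ∀ t : ℕ, ‖scaledSign h w (blockSign L ω (t + 1)) - scaledSign h w (blockSign L ω t)‖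
      ≤ ((((t + 1) / L : ℕ) : ℝ) - ((t / L : ℕ) : ℝ)) * (2 * Real.sqrt d * h * w) := fun t => by
    rcases (Nat.div_le_div_right (c := L) t.le_succ).eq_or_lt with he | hlt
    · have : blockSign L ω (t + 1) = blockSign L ω t := by
        ext i
        simp only [blockSign]
        rw [← Nat.succ_eq_add_one, ← he]
      simp only [this, ← Nat.succ_eq_add_one, ← he, sub_self, norm_zero, zero_mul, le_refl]
    · refine (norm_scaledSign_sub_le hh hw (abs_blockSign L ω _) (abs_blockSign L ω _)).trans ?_
      refine le_mul_of_one_le_left hC ?_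
      have : ((t / L + 1 : ℕ) : ℝ) ≤ ((t + 1) / L : ℕ) := by exact_mod_cast hlt
      push_cast at this ⊢
      linarith
  unfold pathLength
  refine (Finset.sum_le_sum fun t _ => hstep t).trans_eq ?_
  rw [← Finset.sum_mul, Finset.sum_range_sub (fun t => ((t / L : ℕ) : ℝ))]
  simp

end Blocks

/-! ### Assouad's argument -/

namespace BanditAlgorithm

variable {T d : ℕ} [NeZero T] {S : Type*} [MeasurableSpace S] (π : BanditAlgorithm d S)
  (ρ : Measure S) [IsProbabilityMeasure ρ] (F : Measure ℝ) [IsProbabilityMeasure F]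
  {γ ε h : ℝ}

/-- The losses whose signs are given by `ω` on blocks of length `L`. -/
noncomputable def blockLoss (γ ε h : ℝ) (L : ℕ) (ω : Fin T × Fin d → Bool) (t : ℕ) :
    Euc d → ℝ :=
  perturbedLoss γ ε h (blockSign L ω t)

lemma measurable_blockLoss (L : ℕ) (ω : Fin T × Fin d → Bool) (t : ℕ) :
    Measurable (blockLoss γ ε h L ω t) :=
  (contDiff_perturbedLoss (n := 0)).continuous.measurable

/-- The event that coordinate `i` of the action of round `t` does not have the sign of the
minimizer. -/
def wrongSign (γ ε h : ℝ) (L : ℕ) (ω : Fin T × Fin d → Bool) (t : ℕ) (i : Fin d) :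
    Set (S × (ℕ → ℝ)) :=
  {p | blockSign L ω t i * (π.action (blockLoss γ ε h L ω) p.1 p.2 t) i ≤ 0}

lemma measurableSet_mul_act_nonpos (t : ℕ) (a : ℝ) (i : Fin d) :
    MeasurableSet {x : S × (Fin t → Euc d × ℝ) | a * (π.act t x.1 x.2) i ≤ 0} := by
  have h1 : Measurable fun x : S × (Fin t → Euc d × ℝ) => (π.act t x.1 x.2) i :=
    (EuclideanSpace.proj (𝕜 := ℝ) i).continuous.measurable.comp (π.measurable_act t)
  exact measurableSet_le (h1.const_mul a) measurable_const

lemma measurable_action {f : ℕ → Euc d → ℝ} (hf : ∀ t, Measurable (f t)) (t : ℕ) :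
    Measurable fun p : S × (ℕ → ℝ) => π.action f p.1 p.2 t :=
  (π.measurable_act t).comp (π.measurable_history hf t)

lemma measurableSet_wrongSign (L : ℕ) (ω : Fin T × Fin d → Bool) (t : ℕ) (i : Fin d) :
    MeasurableSet (π.wrongSign γ ε h L ω t i) :=
  π.measurable_history (measurable_blockLoss L ω) t (π.measurableSet_mul_act_nonpos t _ i)

omit [IsProbabilityMeasure ρ] [IsProbabilityMeasure F] in
lemma measureReal_wrongSign (L : ℕ) (ω : Fin T × Fin d → Bool) (t : ℕ) (i : Fin d) :
    (ρ.prod (Measure.infinitePi fun _ : ℕ => F)).real (π.wrongSign γ ε h L ω t i) =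
      (π.historyLaw ρ F (blockLoss γ ε h L ω) t).real
        {x | blockSign L ω t i * (π.act t x.1 x.2) i ≤ 0} := by
  rw [historyLaw, map_measureReal_apply (π.measurable_history (measurable_blockLoss L ω) t)
    (π.measurableSet_mul_act_nonpos t _ i)]
  rfl

lemma exp_le_measureReal_wrongSign_add {I₀ K : ℝ} {v₀ : ℝ≥0∞} (hF : ShiftKLCondition F I₀ v₀)
    (hI₀ : 0 ≤ I₀) (hε : 0 ≤ ε) (hv : ENNReal.ofReal (2 * (ε * h ^ 2)) < v₀) {L : ℕ} (hL : 0 < L)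
    (hK : L * (I₀ * (2 * (ε * h ^ 2)) ^ 2) ≤ K) (ω : Fin T × Fin d → Bool) {t : ℕ} (ht : t < T)
    (i : Fin d) :
    Real.exp (-2 * (K + 1)) / 2 ≤
      (ρ.prod (Measure.infinitePi fun _ : ℕ => F)).real (π.wrongSign γ ε h L ω t i) +
      (ρ.prod (Measure.infinitePi fun _ : ℕ => F)).real
        (π.wrongSign γ ε h L (flipSign (Fin.ofNat T (t / L), i) ω) t i) := by
  set ω' := flipSign (Fin.ofNat T (t / L), i) ω with hω'
  have := π.isProbabilityMeasure_historyLaw ρ F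
    (measurable_blockLoss (γ := γ) (ε := ε) (h := h) L ω) t
  have := π.isProbabilityMeasure_historyLaw ρ F
    (measurable_blockLoss (γ := γ) (ε := ε) (h := h) L ω') t
  have hkl : klDiv (π.historyLaw ρ F (blockLoss γ ε h L ω) t)
      (π.historyLaw ρ F (blockLoss γ ε h L ω') t) ≤ ENNReal.ofReal K := by
    refine (π.klDiv_historyLaw_le ρ F hF hI₀ (measurable_blockLoss L ω)
      (measurable_blockLoss L ω')
      (δ := fun k => if k / L = t / L then 2 * (ε * h ^ 2) else 0) (fun k => ?_) t
      fun k hk x => ?_).trans ?_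
    · split_ifs
      · exact hv
      · simpa using bot_le.trans_lt hv
    · split_ifs with hkt
      · refine abs_perturbedLoss_sub_le hε i (fun j hj => ?_) x
        refine (blockSign_flipSign_of_ne L ω fun he => hj ?_).symm
        exact congrArg Prod.snd he
      · rw [blockLoss, blockLoss, hω', blockSign_flipSign_of_div_ne ω (hk.trans ht) ht hkt]
        simp
    · have h0 : ∀ k : ℕ, ENNReal.ofReal
          (I₀ * (if k / L = t / L then 2 * (ε * h ^ 2) else 0) ^ 2) =
          if k / L = t / L then ENNReal.ofReal (I₀ * (2 * (ε * h ^ 2)) ^ 2) else 0 := fun k => by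
        split_ifs <;> simp
      simp_rw [h0]
      rw [← Finset.sum_filter, Finset.sum_const, nsmul_eq_mul]
      calc _ ≤ (L : ℝ≥0∞) * ENNReal.ofReal (I₀ * (2 * (ε * h ^ 2)) ^ 2) := by
            gcongr
            exact card_filter_div_eq_le hL _ _
        _ = ENNReal.ofReal (L * (I₀ * (2 * (ε * h ^ 2)) ^ 2)) := by
            rw [ENNReal.ofReal_mul (Nat.cast_nonneg L), ENNReal.ofReal_natCast]
        _ ≤ _ := ENNReal.ofReal_le_ofReal hK
  have hK0 : 0 ≤ K := le_trans (by positivity) hK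
  rw [measureReal_wrongSign, measureReal_wrongSign]
  refine (exp_le_measureReal_add_measureReal_compl _ _ hK0 hkl
    (π.measurableSet_mul_act_nonpos t (blockSign L ω t i) i)).trans ?_
  gcongr
  · exact measure_ne_top _ _
  -- The set on which the test for `ω` succeeds lies in the wrong-sign set for the flipped pattern:
  -- a coordinate cannot be strictly on both sides of 0.
  · intro x hx
    simp only [mem_compl_iff, mem_ofPred_eq, not_le] at hx ⊢
    rw [hω', blockSign_flipSign_self]
    linarith

lemma sum_measureReal_wrongSign_le_regret {α β M w : ℝ} (hα : 0 < α) (hε : 0 ≤ ε)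
    (hγ : γ = α + ε) (hβ : γ + ε ≤ β) (hh : 0 < h) (hM : γ / 4 + d * (ε * h ^ 2) ≤ M)
    (hw : 0 ≤ w) (hwε : γ * w = ε * Real.cos w) (L : ℕ) (ω : Fin T × Fin d → Bool) (N : ℕ) :
    ∑ t ∈ Finset.range N, ∑ i, α / 2 * h ^ 2 * w ^ 2 *
        (ρ.prod (Measure.infinitePi fun _ : ℕ => F)).real (π.wrongSign γ ε h L ω t i) ≤
      π.regret ρ F (blockLoss γ ε h L ω) N fun t => scaledSign h w (blockSign L ω t) := by
  refine Finset.sum_le_sum fun t _ => ?_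
  set Q := ρ.prod (Measure.infinitePi fun _ : ℕ => F)
  set c := α / 2 * h ^ 2 * w ^ 2
  have hmem : ∀ t, blockLoss γ ε h L ω t ∈ lossClass d α β M := fun t =>
    perturbedLoss_mem_lossClass hα hε hγ hβ hh (abs_blockSign L ω t) hM
  have hint : Integrable (fun p : S × (ℕ → ℝ) =>
      blockLoss γ ε h L ω t (π.action (blockLoss γ ε h L ω) p.1 p.2 t)) Q := by
    refine Integrable.of_bound (C := M) ?_ (.of_forall fun p => ?_)
    · exact ((measurable_blockLoss L ω t).comp
        (π.measurable_action (measurable_blockLoss L ω) t)).aestronglyMeasurable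
    · exact (hmem t).2.2 _ (π.act_mem _ _ _)
  have hi : ∀ i, Integrable ((π.wrongSign γ ε h L ω t i).indicator fun _ => c) Q := fun i =>
    (integrable_const c).indicator (π.measurableSet_wrongSign L ω t i)
  calc ∑ i, c * Q.real (π.wrongSign γ ε h L ω t i)
      = ∑ i, ∫ p, (π.wrongSign γ ε h L ω t i).indicator (fun _ => c) p ∂Q := by
        refine Finset.sum_congr rfl fun i _ => ?_
        rw [integral_indicator_const _ (π.measurableSet_wrongSign L ω t i), smul_eq_mul, mul_comm]
    _ = ∫ p, ∑ i, (π.wrongSign γ ε h L ω t i).indicator (fun _ => c) p ∂Q :=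
        (integral_finsetSum _ fun i _ => hi i).symm
    _ ≤ _ := by
        refine integral_mono (integrable_finsetSum _ fun i _ => hi i)
          (hint.sub (integrable_const _)) fun p => ?_
        refine le_trans (Finset.sum_le_sum fun i _ => le_of_eq ?_)
          (sum_indicator_le_perturbedLoss_sub hα.le hε hγ hh hw hwε (abs_blockSign L ω t) _)
        by_cases hp : p ∈ π.wrongSign γ ε h L ω t i
        · exact (indicator_of_mem hp _).trans (if_pos hp).symm
        · exact (indicator_of_notMem hp _).trans (if_neg hp).symm

/-- Flipping the sign of the current block and coordinate is an involution of the patterns, so the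
two-point bound holds on average with half its constant. Some pattern does at least as badly as the
average. -/
lemma exists_le_regret {α β M w I₀ K : ℝ} {v₀ : ℝ≥0∞} (hα : 0 < α) (hε : 0 ≤ ε)
    (hγ : γ = α + ε) (hβ : γ + ε ≤ β) (hh : 0 < h) (hM : γ / 4 + d * (ε * h ^ 2) ≤ M)
    (hw : 0 ≤ w) (hwε : γ * w = ε * Real.cos w) (hF : ShiftKLCondition F I₀ v₀)
    (hI₀ : 0 ≤ I₀) (hv : ENNReal.ofReal (2 * (ε * h ^ 2)) < v₀) {L : ℕ} (hL : 0 < L)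
    (hK : L * (I₀ * (2 * (ε * h ^ 2)) ^ 2) ≤ K) :
    ∃ ω : Fin T × Fin d → Bool,
      T * (d * (α / 2 * h ^ 2 * w ^ 2 * (Real.exp (-2 * (K + 1)) / 4))) ≤
        π.regret ρ F (blockLoss γ ε h L ω) T fun t => scaledSign h w (blockSign L ω t) := by
  set Q := ρ.prod (Measure.infinitePi fun _ : ℕ => F)
  have hpair : ∀ t < T, ∀ i : Fin d,
      (Fintype.card (Fin T × Fin d → Bool) : ℝ) * (Real.exp (-2 * (K + 1)) / 4) ≤
        ∑ ω : Fin T × Fin d → Bool, Q.real (π.wrongSign γ ε h L ω t i) := by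
    intro t ht i
    have hflip := Equiv.sum_comp (flipSign_involutive (Fin.ofNat T (t / L), i)).toPerm
      fun ω => Q.real (π.wrongSign γ ε h L ω t i)
    have hsum : (Fintype.card (Fin T × Fin d → Bool) : ℝ) * (Real.exp (-2 * (K + 1)) / 2) ≤
        ∑ ω : Fin T × Fin d → Bool, (Q.real (π.wrongSign γ ε h L ω t i) +
          Q.real (π.wrongSign γ ε h L (flipSign (Fin.ofNat T (t / L), i) ω) t i)) := by
      rw [← nsmul_eq_mul, ← Finset.card_univ]
      exact Finset.card_nsmul_le_sum _ _ _ fun ω _ =>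
        π.exp_le_measureReal_wrongSign_add ρ F hF hI₀ hε hv hL hK ω ht i
    rw [Finset.sum_add_distrib] at hsum
    simp only [Function.Involutive.coe_toPerm] at hflip
    linarith
  suffices hsum : ∑ _ω : Fin T × Fin d → Bool,
      (T * (d * (α / 2 * h ^ 2 * w ^ 2 * (Real.exp (-2 * (K + 1)) / 4))) : ℝ) ≤
      ∑ ω : Fin T × Fin d → Bool, π.regret ρ F (blockLoss γ ε h L ω) T fun t =>
        scaledSign h w (blockSign L ω t) by
    obtain ⟨ω, -, hω⟩ := Finset.exists_le_of_sum_le Finset.univ_nonempty hsum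
    exact ⟨ω, hω⟩
  calc _ = ∑ t ∈ Finset.range T, ∑ i : Fin d, α / 2 * h ^ 2 * w ^ 2 *
        ((Fintype.card (Fin T × Fin d → Bool) : ℝ) * (Real.exp (-2 * (K + 1)) / 4)) := by
        simp only [Finset.sum_const, Finset.card_univ, Finset.card_range, nsmul_eq_mul,
          Fintype.card_fin]
        ring
    _ ≤ ∑ t ∈ Finset.range T, ∑ i : Fin d, α / 2 * h ^ 2 * w ^ 2 *
        ∑ ω : Fin T × Fin d → Bool, Q.real (π.wrongSign γ ε h L ω t i) := by
        gcongr with t ht i _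
        exact hpair t (Finset.mem_range.1 ht) i
    _ = ∑ ω : Fin T × Fin d → Bool, ∑ t ∈ Finset.range T, ∑ i : Fin d, α / 2 * h ^ 2 * w ^ 2 *
        Q.real (π.wrongSign γ ε h L ω t i) := by
        simp_rw [Finset.mul_sum]
        rw [Finset.sum_comm (s := (Finset.univ : Finset (Fin T × Fin d → Bool)))]
        exact Finset.sum_congr rfl fun t _ => Finset.sum_comm
    _ ≤ _ := Finset.sum_le_sum fun ω _ =>
        π.sum_measureReal_wrongSign_le_regret ρ F hα hε hγ hβ hh hM hw hwε L ω T

/-- The lower bound for the path-length regret for a given block length `L` and scale `h`. -/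
lemma le_iSup_pathRegret {α β M w I₀ K P : ℝ} {v₀ : ℝ≥0∞} (hα : 0 < α) (hε : 0 ≤ ε)
    (hγ : γ = α + ε) (hβ : γ + ε ≤ β) (hh : 0 < h) (hM : γ / 4 + d * (ε * h ^ 2) ≤ M)
    (hw : 0 ≤ w) (hw1 : w ≤ 1) (hwε : γ * w = ε * Real.cos w) (hF : ShiftKLCondition F I₀ v₀)
    (hI₀ : 0 ≤ I₀) (hv : ENNReal.ofReal (2 * (ε * h ^ 2)) < v₀) {L : ℕ} (hL : 0 < L)
    (hK : L * (I₀ * (2 * (ε * h ^ 2)) ^ 2) ≤ K) (hd : d * h ^ 2 ≤ 1)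
    (hP : ((T - 1) / L : ℕ) * (2 * Real.sqrt d * h) ≤ P) :
    ((T * (d * (α / 2 * h ^ 2 * w ^ 2 * (Real.exp (-2 * (K + 1)) / 4))) : ℝ) : EReal) ≤
      ⨆ f ∈ {f : ℕ → Euc d → ℝ | ∀ t, f t ∈ lossClass d α β M}, pathRegret π ρ F f T P := by
  obtain ⟨ω, hω⟩ := π.exists_le_regret (T := T) ρ F hα hε hγ hβ hh hM hw hwε hF hI₀ hv hL hK
  have hd' : Real.sqrt d * h ≤ 1 := by
    refine le_of_sq_le_sq ?_ (by norm_num)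
    rw [mul_pow, Real.sq_sqrt (by positivity)]
    simpa using hd
  refine le_iSup₂_of_le (blockLoss γ ε h L ω) (fun t =>
    perturbedLoss_mem_lossClass hα hε hγ hβ hh (abs_blockSign L ω t) hM) ?_
  refine le_iSup₂_of_le (fun t => scaledSign h w (blockSign L ω t)) ⟨fun t _ =>
    scaledSign_mem_armSet hh.le hw hw1 hd' (abs_blockSign L ω t), ?_⟩ (EReal.coe_le_coe hω)
  refine (pathLength_scaledSign_le hh.le hw L ω T).trans (le_trans ?_ hP)
  exact mul_le_mul_of_nonneg_left (mul_le_of_le_one_right (by positivity) hw1) (by positivity)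

end BanditAlgorithm

/-! ### Choice of the block length and of the scale -/

lemma rpow_mul_rpow_eq_mul {d T P : ℝ} (hd : 0 ≤ d) (hT : 0 < T) (hP : 0 < P) :
    (d ^ 2 * P) ^ (2 / 5 : ℝ) * T ^ (3 / 5 : ℝ) * (T * Real.sqrt d / P) ^ (2 / 5 : ℝ) = T * d := by
  have h1 : d ^ 2 * P * (T * Real.sqrt d / P) = T * Real.sqrt d ^ 5 := by
    have := Real.sq_sqrt hd
    field_simp
    linear_combination (-(Real.sqrt d ^ 2) - d) * Real.sqrt d * this
  have h2 : (Real.sqrt d ^ 5) ^ (2 / 5 : ℝ) = d := by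
    rw [← Real.rpow_natCast, ← Real.rpow_mul (Real.sqrt_nonneg d)]
    norm_num
    exact Real.sq_sqrt hd
  rw [mul_right_comm, ← Real.mul_rpow (by positivity) (by positivity), h1,
    Real.mul_rpow hT.le (by positivity), h2, mul_right_comm, ← Real.rpow_add hT]
  norm_num

/-- `η` is the threshold for `h²`. It depends on `d`, but enters only `T₀`. Writing `d + 1` avoids
dividing by zero. -/
lemma exists_pos_scale {d : ℕ} {ε m : ℝ} {v₀ : ℝ≥0∞} (hε : 0 < ε) (hm : 0 < m) (hv₀ : 0 < v₀) :
    ∃ η : ℝ, 0 < η ∧ d * η ≤ 1 ∧ d * (ε * η) ≤ m ∧ ENNReal.ofReal (2 * (ε * η)) < v₀ := by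
  obtain ⟨v, hv, hv'⟩ : ∃ v : ℝ, 0 < v ∧ ENNReal.ofReal v < v₀ := by
    obtain ⟨a, -, ha0, ha⟩ := ENNReal.lt_iff_exists_real_btwn.1 hv₀
    exact ⟨a, ENNReal.ofReal_pos.1 ha0, ha⟩
  have hd : (0 : ℝ) < d + 1 := by positivity
  refine ⟨min (1 / (d + 1)) (min (m / ((d + 1) * ε)) (v / (2 * ε))), by positivity, ?_, ?_, ?_⟩
  · calc d * _ ≤ ((d : ℝ) + 1) * (1 / (d + 1)) := by
          gcongr
          · linarith
          · exact min_le_left _ _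
      _ = 1 := by field_simp
  · calc d * (ε * _) ≤ ((d : ℝ) + 1) * (ε * (m / ((d + 1) * ε))) := by
          gcongr
          · linarith
          · exact (min_le_right _ _).trans (min_le_left _ _)
      _ = m := by field_simp
  · refine (ENNReal.ofReal_le_ofReal ?_).trans_lt hv'
    calc 2 * (ε * _) ≤ 2 * (ε * (v / (2 * ε))) := by
          gcongr
          exact (min_le_right _ _).trans (min_le_right _ _)
      _ = v := by field_simp

/-- The hypothesis on `L` amounts to `T√d/P ≤ L^(5/4)`, which is the path-length constraint `(T/L)
√d L^(-1/4) ≤ P`. -/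
lemma div_mul_rpow_le_of_le {d T P : ℝ} {L : ℕ} (hT : 0 ≤ T) (hP : 0 < P)
    (hL : (T * Real.sqrt d / P) ^ (4 / 5 : ℝ) ≤ L) (hL0 : 0 < L) :
    T / L * (2 * Real.sqrt d * (1 / 2 * (L : ℝ) ^ (-(1 / 4) : ℝ))) ≤ P := by
  have hL' : (0 : ℝ) < L := by exact_mod_cast hL0
  have h1 : T * Real.sqrt d / P ≤ (L : ℝ) ^ (5 / 4 : ℝ) := by
    calc T * Real.sqrt d / P = ((T * Real.sqrt d / P) ^ (4 / 5 : ℝ)) ^ (5 / 4 : ℝ) := by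
          rw [← Real.rpow_mul (by positivity)]
          norm_num
      _ ≤ _ := by gcongr
  have h2 : (L : ℝ) ^ (5 / 4 : ℝ) = L / (L : ℝ) ^ (-(1 / 4) : ℝ) := by
    rw [eq_div_iff (by positivity), ← Real.rpow_add hL']
    norm_num
  rw [h2, div_le_div_iff₀ hP (by positivity)] at h1
  rw [div_mul_eq_mul_div, div_le_iff₀ hL']
  linarith

theorem mainTheorem4 (α β M I₀ : ℝ) (v₀ : ℝ≥0∞) (hα : 0 < α) (hαβ : α < β) (hαM : α < 4 * M)
    (hI₀ : 0 < I₀) (hv₀ : 0 < v₀) :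
    ∃ c₂ : ℝ, 0 < c₂ ∧
      ∀ (d : ℕ) (P : ℝ), 1 ≤ d → 0 ≤ P →
        ∃ T₀ : ℕ, 0 < T₀ ∧ ∀ T : ℕ, T₀ ≤ T →
          ∀ (F : Measure ℝ) [IsProbabilityMeasure F], ShiftKLCondition F I₀ v₀ →
            ∀ (S : Type*) [MeasurableSpace S] (ρ : Measure S) [IsProbabilityMeasure ρ]
              (π : BanditAlgorithm d S),
              ((c₂ * ((d : ℝ) ^ 2 * P) ^ (2 / 5 : ℝ) * (T : ℝ) ^ (3 / 5 : ℝ) : ℝ) : EReal) ≤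
                ⨆ f ∈ {f : ℕ → Euc d → ℝ | ∀ t, f t ∈ lossClass d α β M},
                  pathRegret π ρ F f T P := by
  obtain ⟨ε, hε, hεβ, hεM⟩ : ∃ ε : ℝ, 0 < ε ∧ α + ε + ε ≤ β ∧ (α + ε) / 4 < M := by
    refine ⟨min ((β - α) / 2) ((4 * M - α) / 2), ?_, ?_, ?_⟩
    · exact lt_min (by linarith) (by linarith)
    · linarith [min_le_left ((β - α) / 2) ((4 * M - α) / 2)]
    · linarith [min_le_right ((β - α) / 2) ((4 * M - α) / 2)]
  obtain ⟨w, hw, hw1, hwε⟩ := exists_mul_eq_mul_cos hε (le_add_of_nonneg_left hα.le : ε ≤ α + ε)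
  set K := I₀ * ε ^ 2 / 4 with hK
  set c := α / 2 * w ^ 2 * (Real.exp (-2 * (K + 1)) / 4) with hc
  have hc0 : 0 < c := by positivity
  refine ⟨c / 8, by positivity, fun d P hd hP => ?_⟩
  obtain ⟨η, hη, hηd, hηM, hηv⟩ := exists_pos_scale (d := d) hε (sub_pos.2 hεM) hv₀
  have hscale : ∀ h : ℝ, h ^ 2 ≤ η → (α + ε) / 4 + d * (ε * h ^ 2) ≤ M ∧
      ENNReal.ofReal (2 * (ε * h ^ 2)) < v₀ ∧ d * h ^ 2 ≤ 1 := fun h hh => by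
    refine ⟨?_, (ENNReal.ofReal_le_ofReal (by gcongr)).trans_lt hηv,
      le_trans (by gcongr) hηd⟩
    have : d * (ε * h ^ 2) ≤ d * (ε * η) := by gcongr
    linarith
  rcases hP.eq_or_lt with rfl | hP
  -- For `P = 0` the target is 0. A single block `L = T` gives constant comparators and a
  -- nonnegative lower bound.
  · refine ⟨1, one_pos, fun T hT F _ hF S _ ρ _ π => ?_⟩
    have : NeZero T := ⟨by lia⟩
    have hη2 : (Real.sqrt η) ^ 2 = η := Real.sq_sqrt hη.le
    obtain ⟨h1, h2, h3⟩ := hscale (Real.sqrt η) hη2.le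
    refine le_trans (EReal.coe_le_coe ?_) (π.le_iSup_pathRegret (T := T) (L := T) ρ F hα hε.le rfl
      hεβ (Real.sqrt_pos.2 hη) h1 hw.le hw1 hwε hF hI₀.le h2 hT le_rfl h3 ?_)
    · rw [mul_zero, Real.zero_rpow (by norm_num), mul_zero, zero_mul]
      positivity
    · rw [Nat.div_eq_of_lt (by lia)]
      simp
  have hd0 : (0 : ℝ) < d := by exact_mod_cast hd
  have hlim : Filter.Tendsto (fun T : ℕ => ((T : ℝ) * Real.sqrt d / P) ^ (4 / 5 : ℝ))
      Filter.atTop Filter.atTop := by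
    refine (tendsto_rpow_atTop (by norm_num)).comp ?_
    exact (tendsto_natCast_atTop_atTop.atTop_mul_const (by positivity)).atTop_div_const hP
  -- The bound 1 controls the rounding of `L`; the bound `(1/(4η))²` gives `h² = 1/(4√L) ≤ η`.
  obtain ⟨T₁, hT₁⟩ := Filter.eventually_atTop.1
    (hlim.eventually_ge_atTop (max 1 ((1 / (4 * η)) ^ 2)))
  refine ⟨T₁ + 1, by lia, fun T hT F _ hF S _ ρ _ π => ?_⟩
  have : NeZero T := ⟨by lia⟩
  have hT0 : (0 : ℝ) < T := by exact_mod_cast (by lia : 0 < T)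
  have hX := hT₁ T (by lia)
  set X := ((T : ℝ) * Real.sqrt d / P) ^ (4 / 5 : ℝ) with hXdef
  have hX1 : 1 ≤ X := (le_max_left _ _).trans hX
  set L := ⌈X⌉₊ with hLdef
  have hXL : X ≤ L := Nat.le_ceil X
  have hL0 : 0 < L := Nat.ceil_pos.2 (by linarith)
  have hL' : (0 : ℝ) < L := by exact_mod_cast hL0
  -- In fact `L ≤ 2X`; the factor 4 is a perfect square, which keeps `√L` clean.
  have hL4 : (L : ℝ) ≤ 4 * X := by linarith [Nat.ceil_lt_add_one (by linarith : 0 ≤ X)]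
  set h := 1 / 2 * (L : ℝ) ^ (-(1 / 4) : ℝ) with hh
  have hh0 : 0 < h := by positivity
  have hsq : h ^ 2 = 1 / (4 * Real.sqrt L) := by
    rw [hh, mul_pow, ← Real.rpow_natCast ((L : ℝ) ^ _), ← Real.rpow_mul hL'.le, Real.sqrt_eq_rpow,
      one_div (4 * _), mul_inv, ← Real.rpow_neg hL'.le]
    norm_num
  have hsL : 0 < Real.sqrt L := Real.sqrt_pos.2 hL'
  have hhη : h ^ 2 ≤ η := by
    have : 1 / (4 * η) ≤ Real.sqrt L :=
      Real.le_sqrt_of_sq_le (((le_max_right _ _).trans hX).trans hXL)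
    rw [hsq, div_le_iff₀ (by positivity)]
    rw [div_le_iff₀ (by positivity)] at this
    linarith
  obtain ⟨h1, h2, h3⟩ := hscale h hhη
  have hKL : L * (I₀ * (2 * (ε * h ^ 2)) ^ 2) ≤ K := by
    refine le_of_eq ?_
    have := Real.sq_sqrt hL'.le
    rw [hsq, hK]
    field_simp
    rw [this]
    ring
  refine le_trans (EReal.coe_le_coe ?_) (π.le_iSup_pathRegret (T := T) (L := L) ρ F hα hε.le rfl
      hεβ hh0 h1 hw.le hw1 hwε hF hI₀.le h2 hL0 hKL h3 ?_)
  · have hsX : Real.sqrt L ≤ 2 * ((T : ℝ) * Real.sqrt d / P) ^ (2 / 5 : ℝ) := by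
      refine Real.sqrt_le_iff.2 ⟨by positivity, hL4.trans_eq ?_⟩
      rw [mul_pow, hXdef, ← Real.rpow_natCast (_ ^ (2 / 5 : ℝ)), ← Real.rpow_mul (by positivity)]
      norm_num
    -- The rate `A` satisfies `A * Y = T * d`, and `√L ≤ 2Y`. This 2 and the 4 in `h² = 1/(4√L)`
    -- give the factor `1/8`.
    have hY := rpow_mul_rpow_eq_mul hd0.le hT0 hP
    set Y := ((T : ℝ) * Real.sqrt d / P) ^ (2 / 5 : ℝ)
    set A := ((d : ℝ) ^ 2 * P) ^ (2 / 5 : ℝ) * (T : ℝ) ^ (3 / 5 : ℝ) with hA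
    have hA0 : 0 ≤ A := by positivity
    calc c / 8 * ((d : ℝ) ^ 2 * P) ^ (2 / 5 : ℝ) * (T : ℝ) ^ (3 / 5 : ℝ)
        = c * A * Real.sqrt L / (8 * Real.sqrt L) := by
          rw [hA]; field_simp
      _ ≤ c * A * (2 * Y) / (8 * Real.sqrt L) := by gcongr
      _ = c * (A * Y) / (4 * Real.sqrt L) := by ring
      _ = T * (d * (α / 2 * h ^ 2 * w ^ 2 * (Real.exp (-2 * (K + 1)) / 4))) := by
          rw [hY, hsq, hc]; ring
  · refine le_trans ?_ (div_mul_rpow_le_of_le hT0.le hP hXL hL0)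
    gcongr
    calc (((T - 1) / L : ℕ) : ℝ) ≤ ((T / L : ℕ) : ℝ) := by gcongr; lia
      _ ≤ T / L := Nat.cast_div_le
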